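/- Let $S$ be a finite set. A set function $b:2^S\to\mathbb Z\cup\{+\infty\}$ with $b(\emptyset)=0$ is submodular if $b(X)+b(Y)\ge b(X\cap Y)+b(X\cup Y)$ for all $X,Y\subseteq S$ with $b(X),b(Y)$ finite; $p:2^S\to\mathbb Z\cup\{-\infty\}$ is supermodular if $-p$ is submodular. For $m\in\mathbb R^S$ write $\widetilde m(X)=\sum_{s\in X}m(s)$. Let $B\subseteq\mathbb R^S$ be the integral base-polyhedron described by an integer-valued supermodular function $p$ with $p(S)$ finite and by an integer-valued submodular function $b$, that is, $$B=\{x\in\mathbb R^S:\widetilde x(S)=p(S),\ \widetilde x(Z)\ge p(Z)\ \forall Z\subset S\}=\{x\in\mathbb R^S:\widetilde x(S)=b(S),\ \widetilde x(Z)\le b(Z)\ \forall Z\subset S\}.$$ (a) For every $c\in\mathbb Z^S$, $$\min\Big\{\sum_{s\in S}|x(s)-c(s)| : x\in B\cap\mathbb Z^S\Big\}=\max\{p(X)-b(Y)-\widetilde c(X)+\widetilde c(Y) : X,Y\subseteq S,\ X\cap Y=\emptyset\}.$$ (b) For all $c,d\in\mathbb Z^S$ with $c\le d$ (componentwise), $$\min\{\|x-y\|_1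 : x\in B\cap\mathbb Z^S,\ y\in\mathbb Z^S,\ c\le y\le d\}=\max\{p(X)-b(Y)-\widetilde d(X)+\widetilde c(Y) : X,Y\subseteq S,\ X\cap Y=\emptyset\}.$$ In both formulas the minimum and the maximum are attained, and the common value is a finite integer. -/

import Mathlib

namespace DecMin

variable {S : Type*} [Fintype S] [DecidableEq S]

/-- The modular set function `m̃(X) = ∑_{s ∈ X} m(s)` of a real vector `m`. -/
def modular (m : S → ℝ) (X : Finset S) : ℝ := ∑ s ∈ X, m s

/-- The same notation for an integer vector. -/
def modularZ (m : S → ℤ) (X : Finset S) : ℤ := ∑ s ∈ X, m s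

/-- An extended-real number that is an integer or `+∞` or `-∞`. -/
def IsExtInt (r : EReal) : Prop := r = ⊥ ∨ r = ⊤ ∨ ∃ n : ℤ, r = ((n : ℝ) : EReal)

/-- A set function is integer-valued if each of its finite values is an integer. -/
def IntValued (f : Finset S → EReal) : Prop := ∀ X, IsExtInt (f X)

/-- A (fully) submodular function: `b(∅) = 0`, the value `+∞` is allowed but `-∞` is not, and the
submodular inequality holds for every pair of subsets with finite values. -/
structure Submodular (b : Finset S → EReal) : Prop where
  empty : b ∅ = 0
  ne_bot : ∀ X, b X ≠ ⊥
  ineq : ∀ X Y, b X ≠ ⊤ → b Y ≠ ⊤ → b (X ∩ Y) + b (X ∪ Y) ≤ b X + b Y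

/-- A set function `p` is supermodular if `-p` is submodular (so `p(∅) = 0`, the value `-∞` is
allowed but `+∞` is not). -/
def Supermodular (p : Finset S → EReal) : Prop := Submodular (fun X => -p X)

/-- `B(b) = {x ∈ ℝ^S : x̃(S) = b(S), x̃(Z) ≤ b(Z) for all Z}`. -/
def baseOfSub (b : Finset S → EReal) : Set (S → ℝ) :=
  {x | (modular x Finset.univ : EReal) = b Finset.univ ∧ ∀ Z, (modular x Z : EReal) ≤ b Z}

/-- `B'(p) = {x ∈ ℝ^S : x̃(S) = p(S), x̃(Z) ≥ p(Z) for all Z}`. -/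
def baseOfSuper (p : Finset S → EReal) : Set (S → ℝ) :=
  {x | (modular x Finset.univ : EReal) = p Finset.univ ∧ ∀ Z, p Z ≤ (modular x Z : EReal)}

/-- The set of integral members of `B ⊆ ℝ^S`. -/
def intPoints (B : Set (S → ℝ)) : Set (S → ℤ) := {x | (fun s => (x s : ℝ)) ∈ B}

/-- The `ℓ₁`-distance `∑_{s ∈ S} |x(s) - y(s)|` of two integer vectors. -/
def l1dist (x y : S → ℤ) : ℤ := ∑ s, |x s - y s|

/-- The set of values `p(X) - b(Y) - d̃(X) + c̃(Y)` over all disjoint `X, Y ⊆ S`. As `p < +∞` and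
`b > -∞`, no indeterminate difference occurs; the value is `-∞` when `p(X)` or `b(Y)` is infinite. -/
def dualValues (p b : Finset S → EReal) (c d : S → ℤ) : Set EReal :=
  {r | ∃ X Y : Finset S, Disjoint X Y ∧
    r = p X - b Y - ((modularZ d X : ℝ) : EReal) + ((modularZ c Y : ℝ) : EReal)}

end DecMin

/-!
The `ℓ₁`-distance of `x` from the box `[c, d]` is `∑ s, ((x s - d s)⁺ + (c s - x s)⁺)`, so every
base bounds every dual value from above. Conversely let `x` be an integral base nearest to the box.
If `x - χ_s + χ_t` is nearer to the box, then it is not a base, and by integrality this means that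
some set tight for `p` contains `s` but not `t`; equivalently, some set tight for `b` contains `t`
but not `s`. By sub- and supermodularity the tight sets form lattices, so the sets separating single
pairs combine into a `p`-tight `X` with `{x > d} ⊆ X ⊆ {x ≥ d}` and a `b`-tight `Y` disjoint from
`X` with `{x < c} ⊆ Y ⊆ {x ≤ c}`. The dual value of this pair is the distance of `x` from the box.
-/

namespace DecMin

section Order

variable {ι G : Type*}

lemma sum_le_sum_posPart [Fintype ι] [AddCommGroup G] [Lattice G] [IsOrderedAddMonoid G]
    (f : ι → G) (X : Finset ι) : ∑ i ∈ X, f i ≤ ∑ i, (f i)⁺ :=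
  (Finset.sum_le_sum fun i _ => le_posPart (f i)).trans
    (Finset.sum_le_univ_sum_of_nonneg fun i => posPart_nonneg (f i))

lemma sum_eq_sum_posPart [Fintype ι] [AddCommGroup G] [LinearOrder G] [IsOrderedAddMonoid G]
    {f : ι → G} {X : Finset ι} (hpos : ∀ i, 0 < f i → i ∈ X) (hnonneg : ∀ i ∈ X, 0 ≤ f i) :
    ∑ i ∈ X, f i = ∑ i, (f i)⁺ := by
  rw [← Finset.sum_subset (Finset.subset_univ X) fun i _ hi =>
    posPart_eq_zero.2 (not_lt.1 (mt (hpos i) hi))]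
  exact Finset.sum_congr rfl fun i hi => (posPart_eq_self.2 (hnonneg i hi)).symm

lemma exists_mem_separating [Fintype ι] [DecidableEq ι] {F : Set (Finset ι)} (hF : IsSublattice F)
    (hempty : ∅ ∈ F) (huniv : Finset.univ ∈ F) {A C : Finset ι}
    (hsep : ∀ a ∈ A, ∀ c ∈ C, ∃ Z ∈ F, a ∈ Z ∧ c ∉ Z) :
    ∃ Z ∈ F, A ⊆ Z ∧ Disjoint Z C := by
  have hpoint : ∀ a ∈ A, ∃ Z ∈ F, a ∈ Z ∧ Disjoint Z C := by
    intro a ha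
    choose! f hfF hfa hfc using hsep a ha
    refine ⟨C.inf f, Finset.inf_mem F huniv (fun _ hX _ hY => hF.infClosed hX hY) C f hfF, ?_, ?_⟩
    · simpa only [Finset.mem_inf] using hfa
    · exact Finset.disjoint_right.2 fun c hc hcZ => hfc c hc (Finset.mem_inf.1 hcZ c hc)
  choose! g hgF hga hgC using hpoint
  exact ⟨A.sup g, Finset.sup_mem F hempty (fun _ hX _ hY => hF.supClosed hX hY) A g hgF,
    fun a ha => Finset.mem_sup.2 ⟨a, ha, hga a ha⟩, Finset.disjoint_sup_left.2 hgC⟩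

end Order

section Integrality

variable {S : Type*}

lemma IsExtInt.add_one_le {r : EReal} (hr : IsExtInt r) {n : ℤ} (h : ((n : ℝ) : EReal) < r) :
    (((n + 1 : ℤ) : ℝ) : EReal) ≤ r := by
  rcases hr with rfl | rfl | ⟨m, rfl⟩
  · exact absurd h not_lt_bot
  · exact le_top
  · exact_mod_cast h

lemma exists_intCast_le {r : EReal} (hr : r ≠ ⊥) : ∃ n : ℤ, ((n : ℝ) : EReal) ≤ r := by
  induction r with
  | bot => exact absurd rfl hr
  | coe r => exact ⟨⌊r⌋, EReal.coe_le_coe (Int.floor_le r)⟩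
  | top => exact ⟨0, le_top⟩

lemma IntValued.neg {f : Finset S → EReal} (hf : IntValued f) : IntValued (-f) := by
  intro X
  rcases hf X with h | h | ⟨n, h⟩
  · exact Or.inr (Or.inl (by rw [Pi.neg_apply, h, EReal.neg_bot]))
  · exact Or.inl (by rw [Pi.neg_apply, h, EReal.neg_top])
  · exact Or.inr (Or.inr ⟨-n, by rw [Pi.neg_apply, h, Int.cast_neg, EReal.coe_neg]⟩)

lemma modular_intCast (x : S → ℤ) (Z : Finset S) :
    modular (Int.cast ∘ x) Z = (modularZ x Z : ℝ) := by
  simp only [modular, modularZ, Function.comp_apply, Int.cast_sum]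

lemma modular_neg (x : S → ℝ) (Z : Finset S) : modular (-x) Z = -modular x Z :=
  Finset.sum_neg_distrib x

lemma modular_inter_add_union [DecidableEq S] (x : S → ℝ) (X Y : Finset S) :
    modular x (X ∩ Y) + modular x (X ∪ Y) = modular x X + modular x Y :=
  (add_comm _ _).trans Finset.sum_union_inter

lemma modularZ_add_single [DecidableEq S] (x : S → ℤ) (s : S) (k : ℤ) (Z : Finset S) :
    modularZ (x + Pi.single s k) Z = modularZ x Z + if s ∈ Z then k else 0 := by
  simp only [modularZ, Pi.add_apply, Finset.sum_add_distrib, Finset.sum_pi_single']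

end Integrality

section TightSets

variable {S : Type*}

/-- The submodular polyhedron `{x ∈ ℝ^S : x̃(Z) ≤ b(Z) for all Z}`, of which `baseOfSub b` is the
face `x̃(S) = b(S)`. -/
def submodularPolyhedron (b : Finset S → EReal) : Set (S → ℝ) :=
  {x | ∀ Z, (modular x Z : EReal) ≤ b Z}

/-- The sets `Z` whose constraint in `f` is tight at `x`. As this is an equation, it serves for
upper bounds (`f = b`) and for lower bounds (`f = p`) alike. -/
def tightSets (f : Finset S → EReal) (x : S → ℝ) : Set (Finset S) :=
  {Z | f Z = modular x Z}

lemma mem_intPoints_submodularPolyhedron {b : Finset S → EReal} {x : S → ℤ} :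
    x ∈ intPoints (submodularPolyhedron b) ↔ ∀ Z, ((modularZ x Z : ℝ) : EReal) ≤ b Z := by
  simp only [← modular_intCast]
  rfl

lemma mem_tightSets_intCast {f : Finset S → EReal} {x : S → ℤ} {Z : Finset S} :
    Z ∈ tightSets f (Int.cast ∘ x) ↔ f Z = ((modularZ x Z : ℝ) : EReal) := by
  rw [← modular_intCast]
  rfl

lemma tightSets_neg (f : Finset S → EReal) (x : S → ℝ) : tightSets (-f) (-x) = tightSets f x := by
  ext Z
  simp only [tightSets, Set.mem_ofPred_eq, Pi.neg_apply, modular_neg, EReal.coe_neg, neg_inj]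

lemma intCast_comp_neg (x : S → ℤ) : (Int.cast ∘ (-x) : S → ℝ) = -(Int.cast ∘ x) := by
  ext s
  simp only [Function.comp_apply, Pi.neg_apply, Int.cast_neg]

lemma mem_intPoints_submodularPolyhedron_of_le_add_one {b : Finset S → EReal} (hbZ : IntValued b)
    {x y : S → ℤ} (hx : x ∈ intPoints (submodularPolyhedron b))
    (hstep : ∀ Z, modularZ y Z ≤ modularZ x Z + 1)
    (htight : ∀ Z ∈ tightSets b (Int.cast ∘ x), modularZ y Z ≤ modularZ x Z) :
    y ∈ intPoints (submodularPolyhedron b) := by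
  rw [mem_intPoints_submodularPolyhedron] at hx ⊢
  intro Z
  by_cases hZ : b Z = ((modularZ x Z : ℝ) : EReal)
  · rw [hZ]
    exact_mod_cast htight Z (mem_tightSets_intCast.2 hZ)
  · have hle : ((modularZ y Z : ℝ) : EReal) ≤ ((modularZ x Z + 1 : ℤ) : ℝ) := by
      exact_mod_cast hstep Z
    exact hle.trans ((hbZ Z).add_one_le ((hx Z).lt_of_ne' hZ))

lemma intPoints_submodularPolyhedron_nonempty [Finite S] {b : Finset S → EReal}
    (hempty : 0 ≤ b ∅) (hbot : ∀ Z, b Z ≠ ⊥) : (intPoints (submodularPolyhedron b)).Nonempty := by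
  choose f hf using fun Z => exists_intCast_le (hbot Z)
  obtain ⟨N, hN⟩ := (Set.finite_range f).bddBelow
  refine ⟨fun _ => min N 0, mem_intPoints_submodularPolyhedron.2 fun Z => ?_⟩
  rcases Z.eq_empty_or_nonempty with rfl | hZ
  · simpa only [modularZ, Finset.sum_empty, Int.cast_zero, EReal.coe_zero] using hempty
  · refine le_trans ?_ (hf Z)
    have hcard : (1 : ℤ) ≤ Z.card := by exact_mod_cast hZ.card_pos
    have hsum : modularZ (fun _ => min N 0) Z ≤ f Z := calc
      modularZ (fun _ => min N 0) Z = Z.card * min N 0 := by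
        simp only [modularZ, Finset.sum_const, nsmul_eq_mul]
      _ ≤ 1 * min N 0 := mul_le_mul_of_nonpos_right hcard (min_le_right N 0)
      _ ≤ N := (one_mul _).trans_le (min_le_left N 0)
      _ ≤ f Z := hN (Set.mem_range_self Z)
    exact_mod_cast hsum

variable [DecidableEq S]

lemma Submodular.empty_mem_tightSets {b : Finset S → EReal} (hb : Submodular b) (x : S → ℝ) :
    ∅ ∈ tightSets b x := by
  simp only [tightSets, Set.mem_ofPred_eq, hb.empty, modular, Finset.sum_empty, EReal.coe_zero]

lemma Submodular.isSublattice_tightSets {b : Finset S → EReal} (hb : Submodular b) {x : S → ℝ}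
    (hx : x ∈ submodularPolyhedron b) : IsSublattice (tightSets b x) := by
  have hineq : ∀ X ∈ tightSets b x, ∀ Y ∈ tightSets b x,
      b (X ∩ Y) + b (X ∪ Y) ≤ modular x (X ∩ Y) + modular x (X ∪ Y) := by
    intro X (hX : b X = _) Y (hY : b Y = _)
    rw [← EReal.coe_add, modular_inter_add_union, EReal.coe_add, ← hX, ← hY]
    exact hb.ineq X Y (hX ▸ EReal.coe_ne_top _) (hY ▸ EReal.coe_ne_top _)
  constructor <;> intro X hX Y hY <;> refine le_antisymm ?_ (hx _)
  · rw [← (EReal.addLECancellable_coe (modular x (X ∩ Y))).add_le_add_iff_left]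
    exact (add_le_add_left (hx (X ∩ Y)) _).trans (hineq X hX Y hY)
  · rw [← (EReal.addLECancellable_coe (modular x (X ∪ Y))).add_le_add_iff_right]
    exact (add_le_add_right (hx (X ∪ Y)) _).trans (hineq X hX Y hY)

end TightSets

section Bases

variable {S : Type*} [Fintype S]

lemma mem_intPoints_baseOfSub {b : Finset S → EReal} {x : S → ℤ} :
    x ∈ intPoints (baseOfSub b) ↔
      Finset.univ ∈ tightSets b (Int.cast ∘ x) ∧ x ∈ intPoints (submodularPolyhedron b) :=
  and_congr_left' eq_comm

lemma neg_mem_baseOfSub_neg {p : Finset S → EReal} {x : S → ℝ} :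
    -x ∈ baseOfSub (-p) ↔ x ∈ baseOfSuper p := by
  simp only [baseOfSub, baseOfSuper, Set.mem_ofPred_eq, Pi.neg_apply, modular_neg, EReal.coe_neg,
    neg_inj, EReal.neg_le_neg_iff]

lemma neg_mem_intPoints_baseOfSub_neg {p : Finset S → EReal} {x : S → ℤ} :
    -x ∈ intPoints (baseOfSub (-p)) ↔ x ∈ intPoints (baseOfSuper p) := by
  rw [intPoints, intPoints, Set.mem_ofPred_eq, Set.mem_ofPred_eq, ← neg_mem_baseOfSub_neg]
  exact iff_of_eq (congrArg (· ∈ baseOfSub (-p)) (intCast_comp_neg x))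

lemma exists_mem_tightSets_of_isMaxOn {b : Finset S → EReal} (hbZ : IntValued b) {x : S → ℤ}
    (hx : x ∈ intPoints (submodularPolyhedron b))
    (hmax : IsMaxOn (modularZ · Finset.univ) (intPoints (submodularPolyhedron b)) x) (s : S) :
    ∃ Z ∈ tightSets b (Int.cast ∘ x), s ∈ Z := by
  classical
  by_contra! hs
  have hmem : x + Pi.single s 1 ∈ intPoints (submodularPolyhedron b) := by
    refine mem_intPoints_submodularPolyhedron_of_le_add_one hbZ hx (fun Z => ?_) fun Z hZ => ?_
    · rw [modularZ_add_single]
      split_ifs <;> omega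
    · rw [modularZ_add_single, if_neg (hs Z hZ), add_zero]
  have hle : modularZ (x + Pi.single s 1) Finset.univ ≤ modularZ x Finset.univ := hmax hmem
  rw [modularZ_add_single, if_pos (Finset.mem_univ s)] at hle
  omega

variable [DecidableEq S]

lemma mem_intPoints_baseOfSub_of_isMaxOn {b : Finset S → EReal} (hb : Submodular b)
    (hbZ : IntValued b) {x : S → ℤ} (hx : x ∈ intPoints (submodularPolyhedron b))
    (hmax : IsMaxOn (modularZ · Finset.univ) (intPoints (submodularPolyhedron b)) x) :
    x ∈ intPoints (baseOfSub b) := by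
  choose g hg hmem using exists_mem_tightSets_of_isMaxOn hbZ hx hmax
  have hcover : Finset.univ.sup g = Finset.univ :=
    Finset.eq_univ_of_forall fun s => Finset.mem_sup.2 ⟨s, Finset.mem_univ s, hmem s⟩
  have hsup : Finset.univ.sup g ∈ tightSets b (Int.cast ∘ x) :=
    Finset.sup_mem _ (hb.empty_mem_tightSets _)
      (fun _ hX _ hY => (hb.isSublattice_tightSets hx).supClosed hX hY) _ g fun s _ => hg s
  exact mem_intPoints_baseOfSub.2 ⟨hcover ▸ hsup, hx⟩

lemma intPoints_baseOfSub_nonempty {b : Finset S → EReal} (hb : Submodular b)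
    (hbZ : IntValued b) (hbS : b Finset.univ ≠ ⊤) : (intPoints (baseOfSub b)).Nonempty := by
  have hne := intPoints_submodularPolyhedron_nonempty hb.empty.ge hb.ne_bot
  obtain ⟨N, hN⟩ : ∃ N : ℤ, b Finset.univ = ((N : ℝ) : EReal) :=
    ((hbZ Finset.univ).resolve_left (hb.ne_bot _)).resolve_left hbS
  have hbdd : BddAbove ((modularZ · Finset.univ) '' intPoints (submodularPolyhedron b)) := by
    refine ⟨N, Set.forall_mem_image.2 fun x hx => ?_⟩
    have hle := mem_intPoints_submodularPolyhedron.1 hx Finset.univ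
    rw [hN] at hle
    exact_mod_cast hle
  obtain ⟨x, hx, hsup⟩ := Int.csSup_mem (hne.image _) hbdd
  exact ⟨x, mem_intPoints_baseOfSub_of_isMaxOn hb hbZ hx fun y hy =>
    (le_csSup hbdd (Set.mem_image_of_mem _ hy)).trans_eq hsup.symm⟩

lemma intPoints_baseOfSuper_nonempty {p : Finset S → EReal} (hp : Supermodular p)
    (hpZ : IntValued p) (hpS : p Finset.univ ≠ ⊥) : (intPoints (baseOfSuper p)).Nonempty := by
  obtain ⟨x, hx⟩ := intPoints_baseOfSub_nonempty hp hpZ.neg (mt EReal.neg_eq_top_iff.1 hpS)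
  exact ⟨-x, neg_mem_intPoints_baseOfSub_neg.1 (by rwa [neg_neg])⟩

end Bases

section Exchange

variable {S : Type*} [DecidableEq S]

/-- The vector `x - χ_s + χ_t`, which moves one unit from `s` to `t`. -/
def exchange (x : S → ℤ) (s t : S) : S → ℤ := x + Pi.single s (-1) + Pi.single t 1

lemma neg_exchange (x : S → ℤ) (s t : S) : -exchange x s t = exchange (-x) t s := by
  simp only [exchange, Pi.single_neg]
  abel

lemma exchange_apply (x : S → ℤ) (s t u : S) :
    exchange x s t u = x u + (if u = s then -1 else 0) + if u = t then 1 else 0 := by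
  simp only [exchange, Pi.add_apply, Pi.single_apply]

lemma modularZ_exchange (x : S → ℤ) (s t : S) (Z : Finset S) :
    modularZ (exchange x s t) Z =
      modularZ x Z + (if s ∈ Z then -1 else 0) + if t ∈ Z then 1 else 0 := by
  rw [exchange, modularZ_add_single, modularZ_add_single]

variable [Fintype S]

lemma exchange_mem_intPoints_baseOfSub {b : Finset S → EReal} (hbZ : IntValued b) {x : S → ℤ}
    (hx : x ∈ intPoints (baseOfSub b)) {s t : S} :
    exchange x s t ∈ intPoints (baseOfSub b) ↔
      ∀ Z ∈ tightSets b (Int.cast ∘ x), t ∈ Z → s ∈ Z := by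
  rw [mem_intPoints_baseOfSub] at hx ⊢
  constructor
  · rintro ⟨-, hmem⟩ Z hZ ht
    by_contra hs
    have hle := mem_intPoints_submodularPolyhedron.1 hmem Z
    rw [mem_tightSets_intCast.1 hZ, modularZ_exchange, if_neg hs, if_pos ht] at hle
    norm_cast at hle
    omega
  · intro h
    refine ⟨?_, mem_intPoints_submodularPolyhedron_of_le_add_one hbZ hx.2 (fun Z => ?_)
      fun Z hZ => ?_⟩
    · rw [mem_tightSets_intCast, modularZ_exchange, if_pos (Finset.mem_univ s),
        if_pos (Finset.mem_univ t), neg_add_cancel_right]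
      exact mem_tightSets_intCast.1 hx.1
    · rw [modularZ_exchange]
      split_ifs <;> omega
    · have hst := h Z hZ
      rw [modularZ_exchange]
      grind

lemma exchange_mem_intPoints_baseOfSuper {p : Finset S → EReal} (hpZ : IntValued p) {x : S → ℤ}
    (hx : x ∈ intPoints (baseOfSuper p)) {s t : S} :
    exchange x s t ∈ intPoints (baseOfSuper p) ↔
      ∀ Z ∈ tightSets p (Int.cast ∘ x), s ∈ Z → t ∈ Z := by
  rw [← neg_mem_intPoints_baseOfSub_neg] at hx ⊢
  rw [neg_exchange, exchange_mem_intPoints_baseOfSub hpZ.neg hx, intCast_comp_neg, tightSets_neg]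

lemma exists_mem_tightSets_of_exchange_notMem_baseOfSub {b : Finset S → EReal} (hb : Submodular b)
    (hbZ : IntValued b) {x : S → ℤ} (hx : x ∈ intPoints (baseOfSub b)) {A C : Finset S}
    (hAC : ∀ a ∈ A, ∀ c ∈ C, exchange x c a ∉ intPoints (baseOfSub b)) :
    ∃ Z ∈ tightSets b (Int.cast ∘ x), A ⊆ Z ∧ Disjoint Z C := by
  obtain ⟨huniv, hle⟩ := mem_intPoints_baseOfSub.1 hx
  refine exists_mem_separating (F := tightSets b (Int.cast ∘ x)) (hb.isSublattice_tightSets hle)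
    (hb.empty_mem_tightSets _) huniv fun a ha c hc => ?_
  simpa only [exchange_mem_intPoints_baseOfSub hbZ hx, not_forall, exists_prop] using hAC a ha c hc

lemma exists_mem_tightSets_of_exchange_notMem_baseOfSuper {p : Finset S → EReal}
    (hp : Supermodular p) (hpZ : IntValued p) {x : S → ℤ} (hx : x ∈ intPoints (baseOfSuper p))
    {A C : Finset S} (hAC : ∀ a ∈ A, ∀ c ∈ C, exchange x a c ∉ intPoints (baseOfSuper p)) :
    ∃ Z ∈ tightSets p (Int.cast ∘ x), A ⊆ Z ∧ Disjoint Z C := by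
  rw [← tightSets_neg, ← intCast_comp_neg]
  refine exists_mem_tightSets_of_exchange_notMem_baseOfSub (b := -p) hp hpZ.neg
    (neg_mem_intPoints_baseOfSub_neg.2 hx) fun a ha c hc => ?_
  rw [← neg_exchange, neg_mem_intPoints_baseOfSub_neg]
  exact hAC a ha c hc

end Exchange

section BoxDistance

variable {S : Type*} [Fintype S]

/-- The `ℓ₁`-distance of `x` from the box `[c, d]`, provided that `c ≤ d`. -/
def boxDist (c d x : S → ℤ) : ℤ := ∑ s, ((x s - d s)⁺ + (c s - x s)⁺)

lemma boxDist_nonneg (c d x : S → ℤ) : 0 ≤ boxDist c d x :=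
  Finset.sum_nonneg fun _ _ => add_nonneg (posPart_nonneg _) (posPart_nonneg _)

lemma boxDist_le_l1dist {c d y : S → ℤ} (hy : y ∈ Set.Icc c d) (x : S → ℤ) :
    boxDist c d x ≤ l1dist x y := by
  refine Finset.sum_le_sum fun s _ => ?_
  have hc : c s ≤ y s := hy.1 s
  have hd : y s ≤ d s := hy.2 s
  simp only [posPart_def, abs_eq_max_neg]
  omega

lemma exists_l1dist_eq_boxDist {c d : S → ℤ} (hcd : c ≤ d) (x : S → ℤ) :
    ∃ y ∈ Set.Icc c d, l1dist x y = boxDist c d x := by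
  refine ⟨c ⊔ x ⊓ d, ⟨le_sup_left, sup_le hcd inf_le_right⟩, Finset.sum_congr rfl fun s _ => ?_⟩
  have hs : c s ≤ d s := hcd s
  simp only [posPart_def, abs_eq_max_neg, Pi.sup_apply, Pi.inf_apply]
  omega

lemma isLeast_l1dist_of_isMinOn_boxDist {c d x : S → ℤ} (hcd : c ≤ d) {I : Set (S → ℤ)}
    (hx : x ∈ I) (hmin : IsMinOn (boxDist c d) I x) :
    IsLeast {r : ℤ | ∃ x ∈ I, ∃ y ∈ Set.Icc c d, r = l1dist x y} (boxDist c d x) := by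
  obtain ⟨y, hy, hxy⟩ := exists_l1dist_eq_boxDist hcd x
  refine ⟨⟨x, hx, y, hy, hxy.symm⟩, ?_⟩
  rintro _ ⟨x', hx', y', hy', rfl⟩
  exact (hmin hx').trans (boxDist_le_l1dist hy' x')

lemma exists_isMinOn_boxDist (c d : S → ℤ) {I : Set (S → ℤ)} (hI : I.Nonempty) :
    ∃ x ∈ I, IsMinOn (boxDist c d) I x := by
  have hbdd : BddBelow (boxDist c d '' I) :=
    ⟨0, Set.forall_mem_image.2 fun x _ => boxDist_nonneg c d x⟩
  obtain ⟨x, hx, hinf⟩ := Int.csInf_mem (hI.image (boxDist c d)) hbdd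
  exact ⟨x, hx, fun y hy => hinf.trans_le (csInf_le hbdd (Set.mem_image_of_mem _ hy))⟩

lemma modularZ_dual_le_boxDist (c d x : S → ℤ) (X Y : Finset S) :
    modularZ x X - modularZ x Y - modularZ d X + modularZ c Y ≤ boxDist c d x := by
  have hX := sum_le_sum_posPart (fun s => x s - d s) X
  have hY := sum_le_sum_posPart (fun s => c s - x s) Y
  rw [Finset.sum_sub_distrib] at hX hY
  rw [boxDist, Finset.sum_add_distrib]
  simp only [modularZ]
  linarith

lemma modularZ_dual_eq_boxDist {c d x : S → ℤ} {X Y : Finset S}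
    (hX : ∀ s, d s < x s → s ∈ X) (hX' : ∀ s ∈ X, d s ≤ x s)
    (hY : ∀ s, x s < c s → s ∈ Y) (hY' : ∀ s ∈ Y, x s ≤ c s) :
    modularZ x X - modularZ x Y - modularZ d X + modularZ c Y = boxDist c d x := by
  have hsumX := sum_eq_sum_posPart (f := fun s => x s - d s) (X := X)
    (fun s hs => hX s (sub_pos.1 hs)) fun s hs => sub_nonneg.2 (hX' s hs)
  have hsumY := sum_eq_sum_posPart (f := fun s => c s - x s) (X := Y)
    (fun s hs => hY s (sub_pos.1 hs)) fun s hs => sub_nonneg.2 (hY' s hs)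
  rw [Finset.sum_sub_distrib] at hsumX hsumY
  rw [boxDist, Finset.sum_add_distrib]
  simp only [modularZ]
  linarith

variable [DecidableEq S]

lemma boxDist_exchange_lt {c d x : S → ℤ} (hcd : c ≤ d) {s t : S} (hs : c s < x s)
    (ht : x t < d t) (hst : d s < x s ∨ x t < c t) :
    boxDist c d (exchange x s t) < boxDist c d x := by
  have hcs : c s ≤ d s := hcd s
  have hct : c t ≤ d t := hcd t
  have hne : s ≠ t := by
    rintro rfl
    omega
  have hle (u : S) : (exchange x s t u - d u)⁺ + (c u - exchange x s t u)⁺ ≤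
      (x u - d u)⁺ + (c u - x u)⁺ := by
    simp only [exchange_apply, posPart_def]
    split_ifs with hus hut hut <;> subst_vars <;> omega
  refine Finset.sum_lt_sum (fun u _ => hle u) ?_
  rcases hst with hst | hst
  · refine ⟨s, Finset.mem_univ s, ?_⟩
    simp only [exchange_apply, posPart_def, if_pos, if_neg hne]
    omega
  · refine ⟨t, Finset.mem_univ t, ?_⟩
    simp only [exchange_apply, posPart_def, if_pos, if_neg hne.symm]
    omega

lemma exchange_notMem_of_isMinOn_boxDist {c d x : S → ℤ} (hcd : c ≤ d) {I : Set (S → ℤ)}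
    (hmin : IsMinOn (boxDist c d) I x) {s t : S} (hs : c s < x s) (ht : x t < d t)
    (hst : d s < x s ∨ x t < c t) : exchange x s t ∉ I :=
  fun hmem => (boxDist_exchange_lt hcd hs ht hst).not_ge (hmin hmem)

end BoxDistance

section Duality

variable {S : Type*} [Fintype S] {p b : Finset S → EReal} {c d x : S → ℤ}

lemma boxDist_mem_upperBounds_dualValues (hxp : x ∈ intPoints (baseOfSuper p))
    (hxb : x ∈ intPoints (baseOfSub b)) :
    ((boxDist c d x : ℝ) : EReal) ∈ upperBounds (dualValues p b c d) := by
  rintro _ ⟨X, Y, -, rfl⟩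
  have hX : p X ≤ ((modularZ x X : ℝ) : EReal) := modular_intCast x X ▸ hxp.2 X
  have hY : ((modularZ x Y : ℝ) : EReal) ≤ b Y := modular_intCast x Y ▸ hxb.2 Y
  calc p X - b Y - ((modularZ d X : ℝ) : EReal) + ((modularZ c Y : ℝ) : EReal)
      ≤ ((modularZ x X : ℝ) : EReal) - ((modularZ x Y : ℝ) : EReal) -
          ((modularZ d X : ℝ) : EReal) + ((modularZ c Y : ℝ) : EReal) := by
        gcongr
        exact EReal.sub_le_sub (EReal.sub_le_sub hX hY) le_rfl
    _ ≤ ((boxDist c d x : ℝ) : EReal) := by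
        exact_mod_cast modularZ_dual_le_boxDist c d x X Y

variable [DecidableEq S]

lemma exists_tight_pair_of_isMinOn_boxDist (hp : Supermodular p) (hpZ : IntValued p)
    (hb : Submodular b) (hbZ : IntValued b) (hpb : baseOfSuper p = baseOfSub b) (hcd : c ≤ d)
    (hx : x ∈ intPoints (baseOfSub b)) (hmin : IsMinOn (boxDist c d) (intPoints (baseOfSub b)) x) :
    ∃ X ∈ tightSets p (Int.cast ∘ x), ∃ Y ∈ tightSets b (Int.cast ∘ x), Disjoint X Y ∧
      (∀ s, d s < x s → s ∈ X) ∧ (∀ s ∈ X, d s ≤ x s) ∧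
      (∀ s, x s < c s → s ∈ Y) ∧ ∀ s ∈ Y, x s ≤ c s := by
  have hxp : x ∈ intPoints (baseOfSuper p) := hpb ▸ hx
  obtain ⟨X, hXtight, hXsup, hXdisj⟩ :
      ∃ X ∈ tightSets p (Int.cast ∘ x), ({s | d s < x s} : Finset S) ⊆ X ∧
        Disjoint X ({t | x t < d t} : Finset S) := by
    refine exists_mem_tightSets_of_exchange_notMem_baseOfSuper hp hpZ hxp fun s hs t ht => ?_
    rw [Finset.mem_filter_univ] at hs ht
    rw [hpb]
    exact exchange_notMem_of_isMinOn_boxDist hcd hmin ((hcd s).trans_lt hs) ht (Or.inl hs)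
  have hXge : ∀ s ∈ X, d s ≤ x s := fun s hs =>
    not_lt.1 fun h => Finset.disjoint_left.1 hXdisj hs ((Finset.mem_filter_univ s).2 h)
  obtain ⟨Y, hYtight, hYsup, hYdisj⟩ :
      ∃ Y ∈ tightSets b (Int.cast ∘ x), ({t | x t < c t} : Finset S) ⊆ Y ∧
        Disjoint Y (({s | c s < x s} : Finset S) ∪ X) := by
    refine exists_mem_tightSets_of_exchange_notMem_baseOfSub hb hbZ hx fun t ht s hs => ?_
    rw [Finset.mem_filter_univ] at ht
    have htd : x t < d t := ht.trans_le (hcd t)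
    rw [Finset.mem_union, Finset.mem_filter_univ] at hs
    rcases hs with hs | hs
    · exact exchange_notMem_of_isMinOn_boxDist hcd hmin hs htd (Or.inr ht)
    · rw [← hpb, exchange_mem_intPoints_baseOfSuper hpZ hxp]
      exact fun h => (hXge t (h X hXtight hs)).not_gt htd
  obtain ⟨hYle, hYX⟩ := Finset.disjoint_union_right.1 hYdisj
  exact ⟨X, hXtight, Y, hYtight, hYX.symm, fun s hs => hXsup ((Finset.mem_filter_univ s).2 hs),
    hXge, fun s hs => hYsup ((Finset.mem_filter_univ s).2 hs), fun s hs =>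
    not_lt.1 fun h => Finset.disjoint_left.1 hYle hs ((Finset.mem_filter_univ s).2 h)⟩

lemma boxDist_mem_dualValues_of_isMinOn (hp : Supermodular p) (hpZ : IntValued p)
    (hb : Submodular b) (hbZ : IntValued b) (hpb : baseOfSuper p = baseOfSub b) (hcd : c ≤ d)
    (hx : x ∈ intPoints (baseOfSub b)) (hmin : IsMinOn (boxDist c d) (intPoints (baseOfSub b)) x) :
    ((boxDist c d x : ℝ) : EReal) ∈ dualValues p b c d := by
  obtain ⟨X, hXtight, Y, hYtight, hXY, hX, hX', hY, hY'⟩ :=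
    exists_tight_pair_of_isMinOn_boxDist hp hpZ hb hbZ hpb hcd hx hmin
  refine ⟨X, Y, hXY, ?_⟩
  rw [mem_tightSets_intCast.1 hXtight, mem_tightSets_intCast.1 hYtight,
    ← modularZ_dual_eq_boxDist hX hX' hY hY']
  push_cast
  rfl

theorem exists_isLeast_l1dist_isGreatest_dualValues (hp : Supermodular p) (hpZ : IntValued p)
    (hpS : p Finset.univ ≠ ⊥) (hb : Submodular b) (hbZ : IntValued b)
    (hpb : baseOfSuper p = baseOfSub b) (hcd : c ≤ d) :
    ∃ v : ℤ,
      IsLeast {r : ℤ | ∃ x ∈ intPoints (baseOfSub b), ∃ y ∈ Set.Icc c d, r = l1dist x y} v ∧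
      IsGreatest (dualValues p b c d) ((v : ℝ) : EReal) := by
  obtain ⟨x, hx, hmin⟩ :=
    exists_isMinOn_boxDist c d (hpb ▸ intPoints_baseOfSuper_nonempty hp hpZ hpS)
  exact ⟨boxDist c d x, isLeast_l1dist_of_isMinOn_boxDist hcd hx hmin,
    boxDist_mem_dualValues_of_isMinOn hp hpZ hb hbZ hpb hcd hx hmin,
    boxDist_mem_upperBounds_dualValues (hpb ▸ hx) hx⟩

end Duality

end DecMin

theorem mainTheorem11 {S : Type*} [Fintype S] [DecidableEq S]
    (B : Set (S → ℝ)) (p b : Finset S → EReal)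
    (hp : DecMin.Supermodular p) (hpZ : DecMin.IntValued p)
    (hpS : p Finset.univ ≠ ⊥)
    (hb : DecMin.Submodular b) (hbZ : DecMin.IntValued b)
    (hBp : B = DecMin.baseOfSuper p) (hBb : B = DecMin.baseOfSub b) :
    (∀ c : S → ℤ, ∃ v : ℤ,
      IsLeast {r : ℤ | ∃ x ∈ DecMin.intPoints B, r = DecMin.l1dist x c} v ∧
      IsGreatest (DecMin.dualValues p b c c) ((v : ℝ) : EReal)) ∧
    (∀ c d : S → ℤ, c ≤ d → ∃ v : ℤ,
      IsLeast {r : ℤ | ∃ x ∈ DecMin.intPoints B, ∃ y ∈ Set.Icc c d, r = DecMin.l1dist x y} v ∧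
      IsGreatest (DecMin.dualValues p b c d) ((v : ℝ) : EReal)) := by
  subst hBb
  have hbox {c d : S → ℤ} (hcd : c ≤ d) :=
    DecMin.exists_isLeast_l1dist_isGreatest_dualValues hp hpZ hpS hb hbZ hBp.symm hcd
  refine ⟨fun c => ?_, fun c d hcd => hbox hcd⟩
  simpa only [Set.Icc_self, Set.mem_singleton_iff, exists_eq_left] using hbox (le_refl c)
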